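/- Let $T_1,\dots,T_m:\mathbb R^N\to\mathbb R^N$ be non-singular linear maps with $\|T_i\|<1$. Write $I$ for the set of finite words over $\{1,\dots,m\}$ and $I_\infty$ for the space of infinite words, with the product topology. For $\mathbf i=(i_1,\dots,i_k)\in I$ put $T_{\mathbf i}=T_{i_1}\cdots T_{i_k}$ and let $C_{\mathbf i}\subseteq I_\infty$ be the cylinder of infinite words beginning with $\mathbf i$. Let $\alpha_1(T)\ge\dots\ge\alpha_N(T)$ be the singular values of $T$. For $s>0$ let $$\phi^s(T)=\alpha_1\cdots\alpha_{j-1}\alpha_j^{\,s-j+1}\quad (s\le N,\ j\in\mathbb Z,\ j-1<s\le j),\qquad \phi^s(T)=(\alpha_1\cdots\alpha_N)^{s/N}\quad (s>N),$$ and for $r>0$ let $$J^s(r)=\{(i_1,\dots,i_k)\in I:\ \alpha_j(T_{i_1,\dots,i_k})\le r<\alpha_j(T_{i_1,\dots,i_{k-1}})\},$$ where $j-1<s\le j$ if $s\le N$ and $j=N$ if $s>N$. For a finite Borel measure $\mu$ on $I_\infty$ and $q>1$ define, in $[0,\infty]$ and with $\sup\emptyset=0$, $$d_q^-=\sup\Big\{s>0:\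 \limsup_{r\to0}\sum_{\mathbf i\in J^s(r)}\phi^s(T_{\mathbf i})^{1-q}\mu(C_{\mathbf i})^q<\infty\Big\},\qquad d_q^+=\sup\Big\{s>0:\ \liminf_{r\to0}\sum_{\mathbf i\in J^s(r)}\phi^s(T_{\mathbf i})^{1-q}\mu(C_{\mathbf i})^q<\infty\Big\}.$$ Given a bounded family $\omega=(\omega_{\mathbf i})_{\mathbf i\in I}$ in $\mathbb R^N$, let $\mu^\omega$ be the image of $\mu$ under the map $\Pi^\omega:I_\infty\to\mathbb R^N$, $$\Pi^\omega(\mathbf i)=\omega_{i_1}+T_{i_1}\omega_{i_1,i_2}+T_{i_1}T_{i_2}\omega_{i_1,i_2,i_3}+\cdots.$$ For a finite Borel measure $\tau$ on $\mathbb R^N$ let $M_r(q)=\sum_C\tau(C)^q$, the sum being over all cubes $C=\prod_{l=1}^N[z_lr,(z_l+1)r)$ with $z\in\mathbb Z^N$, and let $$\underline D_q(\tau)=\liminf_{r\to0}\frac{\log M_r(q)}{(q-1)\log r},\qquad \overline D_q(\tau)=\limsup_{r\to0}\frac{\log M_r(q)}{(q-1)\log r}.$$ Then for every non-zero finite Borel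 measure $\mu$ on $I_\infty$, every $q>1$ and every bounded family $\omega$, $$\underline D_q(\mu^\omega)\le\min\{d_q^-,N\}\qquad\text{and}\qquad \overline D_q(\mu^\omega)\le\min\{d_q^+,N\}.$$ -/

import Mathlib

open MeasureTheory Filter Topology
open scoped ENNReal

namespace AlmostSelfAffine

noncomputable section

/-- The index `j` with `j - 1 < s ≤ j` when `0 < s ≤ N`. For `s > N` the last index `N` is used,
and for `s = 0` the index `1` (so that `φ^0 = 1`). -/
def svIndex (N : ℕ) (s : ℝ) : ℕ := max 1 (min ⌈s⌉₊ N)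

/-- The `j`-th singular value `α_j` (`j = 1, …, N`), in decreasing order. Mathlib's
`LinearMap.singularValues` counts from `0`. -/
def sv {N : ℕ} (T : EuclideanSpace ℝ (Fin N) →L[ℝ] EuclideanSpace ℝ (Fin N)) (j : ℕ) : ℝ :=
  T.toLinearMap.singularValues (j - 1)

/-- The singular value function `φ^s(T)`, for `s ≥ 0`: it is `α_1 ⋯ α_{j-1} α_j^{s-j+1}` with
`j - 1 < s ≤ j` if `s ≤ N`, and `(α_1 ⋯ α_N)^{s/N}` if `s > N`. -/
def svFun {N : ℕ} (T : EuclideanSpace ℝ (Fin N) →L[ℝ] EuclideanSpace ℝ (Fin N)) (s : ℝ) : ℝ :=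
  if s ≤ N then
    (∏ l ∈ Finset.Ico 1 (svIndex N s), sv T l) *
      sv T (svIndex N s) ^ (s - (svIndex N s : ℝ) + 1)
  else
    (∏ l ∈ Finset.Icc 1 N, sv T l) ^ (s / (N : ℝ))

/-- The composition `T_{i_1} T_{i_2} ⋯ T_{i_k}` along a finite word. -/
def wordMap {N m : ℕ} (T : Fin m → EuclideanSpace ℝ (Fin N) →L[ℝ] EuclideanSpace ℝ (Fin N))
    (w : List (Fin m)) : EuclideanSpace ℝ (Fin N) →L[ℝ] EuclideanSpace ℝ (Fin N) :=
  (w.map T).prod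

/-- The curtailment `i|_k` of an infinite word. -/
def curtail {m : ℕ} (i : ℕ → Fin m) (k : ℕ) : List (Fin m) :=
  List.ofFn fun l : Fin k => i l

/-- The cylinder of all infinite words that begin with `w`. -/
def cylinder {m : ℕ} (w : List (Fin m)) : Set (ℕ → Fin m) :=
  {i | curtail i w.length = w}

/-- The projection
`Π^ω(i) = ω_{i_1} + T_{i_1} ω_{i_1 i_2} + T_{i_1} T_{i_2} ω_{i_1 i_2 i_3} + ⋯`. -/
def projection {N m : ℕ} (T : Fin m → EuclideanSpace ℝ (Fin N) →L[ℝ] EuclideanSpace ℝ (Fin N))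
    (ω : List (Fin m) → EuclideanSpace ℝ (Fin N)) (i : ℕ → Fin m) : EuclideanSpace ℝ (Fin N) :=
  ∑' k : ℕ, wordMap T (curtail i k) (ω (curtail i (k + 1)))

/-- The image `μ^ω` of the measure `μ` on code space under the projection. -/
def projMeasure {N m : ℕ} (T : Fin m → EuclideanSpace ℝ (Fin N) →L[ℝ] EuclideanSpace ℝ (Fin N))
    (ω : List (Fin m) → EuclideanSpace ℝ (Fin N)) (μ : Measure (ℕ → Fin m)) :
    Measure (EuclideanSpace ℝ (Fin N)) :=
  μ.map (projection T ω)

/-- The `r`-mesh cube with integer position `z`. -/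
def meshCube {N : ℕ} (r : ℝ) (z : Fin N → ℤ) : Set (EuclideanSpace ℝ (Fin N)) :=
  {x | ∀ l, (z l : ℝ) * r ≤ x l ∧ x l < ((z l : ℝ) + 1) * r}

/-- The moment sum `M_r(q)` over all `r`-mesh cubes; for `q > 0` null cubes contribute `0`. -/
def momentSum {N : ℕ} (τ : Measure (EuclideanSpace ℝ (Fin N))) (q r : ℝ) : ℝ≥0∞ :=
  ∑' z : Fin N → ℤ, τ (meshCube r z) ^ q

/-- The lower generalised `q`-dimension. -/
def lowerDim {N : ℕ} (q : ℝ) (τ : Measure (EuclideanSpace ℝ (Fin N))) : EReal :=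
  liminf (fun r : ℝ => ENNReal.log (momentSum τ q r) / (((q - 1) * Real.log r : ℝ) : EReal))
    (𝓝[>] 0)

/-- The upper generalised `q`-dimension. -/
def upperDim {N : ℕ} (q : ℝ) (τ : Measure (EuclideanSpace ℝ (Fin N))) : EReal :=
  limsup (fun r : ℝ => ENNReal.log (momentSum τ q r) / (((q - 1) * Real.log r : ℝ) : EReal))
    (𝓝[>] 0)

/-- The cut-set `J^s(r)`: the words `w = i_1 … i_k` with
`α_j(T_{i_1 … i_k}) ≤ r < α_j(T_{i_1 … i_{k-1}})`. The empty word never satisfies this, since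
dropping the last letter leaves it unchanged. -/
def cutSet {N m : ℕ} (T : Fin m → EuclideanSpace ℝ (Fin N) →L[ℝ] EuclideanSpace ℝ (Fin N))
    (s r : ℝ) : Set (List (Fin m)) :=
  {w | sv (wordMap T w) (svIndex N s) ≤ r ∧ r < sv (wordMap T w.dropLast) (svIndex N s)}

/-- The sum of `φ^s(T_w)^{1-q} μ(C_w)^q` over `w ∈ J^s(r)`. -/
def cutSum {N m : ℕ} (T : Fin m → EuclideanSpace ℝ (Fin N) →L[ℝ] EuclideanSpace ℝ (Fin N))
    (μ : Measure (ℕ → Fin m)) (q s r : ℝ) : ℝ≥0∞ :=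
  ∑' w : cutSet T s r,
    ENNReal.ofReal (svFun (wordMap T (w : List (Fin m))) s ^ (1 - q)) *
      μ (cylinder (w : List (Fin m))) ^ q

/-- `d_q^-`: the supremum in `[0, ∞]` (hence `0` for the empty set) of all `s > 0` such that the
cut-set sums have finite upper limit as `r → 0`. -/
def dMinus {N m : ℕ} (T : Fin m → EuclideanSpace ℝ (Fin N) →L[ℝ] EuclideanSpace ℝ (Fin N))
    (μ : Measure (ℕ → Fin m)) (q : ℝ) : ℝ≥0∞ :=
  ⨆ (s : ℝ) (_ : 0 < s ∧ limsup (fun r : ℝ => cutSum T μ q s r) (𝓝[>] 0) < ∞), ENNReal.ofReal s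

/-- `d_q^+`: the supremum in `[0, ∞]` (hence `0` for the empty set) of all `s > 0` such that the
cut-set sums have finite lower limit as `r → 0`. -/
def dPlus {N m : ℕ} (T : Fin m → EuclideanSpace ℝ (Fin N) →L[ℝ] EuclideanSpace ℝ (Fin N))
    (μ : Measure (ℕ → Fin m)) (q : ℝ) : ℝ≥0∞ :=
  ⨆ (s : ℝ) (_ : 0 < s ∧ liminf (fun r : ℝ => cutSum T μ q s r) (𝓝[>] 0) < ∞), ENNReal.ofReal s

end

end AlmostSelfAffine

/-!
The projection maps the cylinder of a word `w` into the ellipsoid `y + T_w(B)` for a fixed ball `B`.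
For `w ∈ J^s(r)` and `s ≤ N` the `j`-th semi-axis of this ellipsoid is comparable to `r`, so it
meets at most a constant times `φ^s(T_w) r^{-s}` of the `r`-mesh cubes, and Hölder's inequality
over these cubes bounds `φ^s(T_w)^{1-q} μ(C_w)^q` by a constant times `r^{-s(q-1)}` times the `q`-th
moment sum of the part of `μ^ω` coming from `C_w`. As the cylinders over `J^s(r)` are disjoint and
`t ↦ t^q` is superadditive, the sum over `w` is at most a constant times `r^{-s(q-1)} M_r(q)`, which
stays bounded along those `r` for which the quotient `log M_r(q) / ((q - 1) log r)` exceeds `s`.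
The bound by `N` comes from the same count of cubes for a box containing the support of `μ^ω`.
-/

namespace AlmostSelfAffine

open Function Module InnerProductSpace

section SingularValues

variable {𝕜 E F G : Type*} [RCLike 𝕜]
  [NormedAddCommGroup E] [InnerProductSpace 𝕜 E] [FiniteDimensional 𝕜 E]
  [NormedAddCommGroup F] [InnerProductSpace 𝕜 F] [FiniteDimensional 𝕜 F]
  [NormedAddCommGroup G] [InnerProductSpace 𝕜 G] [FiniteDimensional 𝕜 G]
  {n : ℕ}

/-- The right singular vectors of `T`, an orthonormal eigenbasis of `T* T` ordered by decreasing
singular value. -/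
noncomputable def rightSingularBasis (T : E →ₗ[𝕜] F) (hn : finrank 𝕜 E = n) :
    OrthonormalBasis (Fin n) 𝕜 E :=
  T.isSymmetric_adjoint_comp_self.eigenvectorBasis hn

theorem inner_map_rightSingularBasis (T : E →ₗ[𝕜] F) (hn : finrank 𝕜 E = n) (l : Fin n) (x : E) :
    inner 𝕜 (T (rightSingularBasis T hn l)) (T x) =
      (T.singularValues l : 𝕜) ^ 2 * inner 𝕜 (rightSingularBasis T hn l) x := by
  have heigen : T.adjoint (T (rightSingularBasis T hn l)) =
      ((T.singularValues l ^ 2 : ℝ) : 𝕜) • rightSingularBasis T hn l := by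
    rw [T.sq_singularValues_fin hn]
    exact T.isSymmetric_adjoint_comp_self.apply_eigenvectorBasis hn l
  rw [← LinearMap.adjoint_inner_left, heigen, inner_smul_left, RCLike.conj_ofReal,
    RCLike.ofReal_pow]

theorem norm_map_sq_eq_sum_rightSingularBasis (T : E →ₗ[𝕜] F) (hn : finrank 𝕜 E = n) (x : E) :
    ‖T x‖ ^ 2 =
      ∑ l : Fin n, T.singularValues l ^ 2 * ‖inner 𝕜 (rightSingularBasis T hn l) x‖ ^ 2 := by
  have hcoe : ((‖T x‖ ^ 2 : ℝ) : 𝕜) = ∑ l : Fin n, (T.singularValues l : 𝕜) ^ 2 *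
      (‖inner 𝕜 (rightSingularBasis T hn l) x‖ : 𝕜) ^ 2 := by
    rw [RCLike.ofReal_pow, ← inner_self_eq_norm_sq_to_K]
    nth_rewrite 1 [← (rightSingularBasis T hn).sum_repr' x]
    rw [map_sum, sum_inner]
    refine Finset.sum_congr rfl fun l _ => ?_
    rw [map_smul, inner_smul_left, inner_map_rightSingularBasis, ← RCLike.conj_mul]
    ring
  exact_mod_cast hcoe

theorem norm_map_le_of_inner_rightSingularBasis_eq_zero (T : E →ₗ[𝕜] F) (hn : finrank 𝕜 E = n)
    {k : ℕ} {x : E} (hx : ∀ l : Fin n, (l : ℕ) < k → inner 𝕜 (rightSingularBasis T hn l) x = 0) :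
    ‖T x‖ ≤ T.singularValues k * ‖x‖ := by
  refine le_of_sq_le_sq ?_ (mul_nonneg (T.singularValues_nonneg k) (norm_nonneg x))
  rw [mul_pow, norm_map_sq_eq_sum_rightSingularBasis T hn,
    ← (rightSingularBasis T hn).sum_sq_norm_inner_right x, Finset.mul_sum]
  refine Finset.sum_le_sum fun l _ => ?_
  rcases lt_or_ge (l : ℕ) k with hl | hl
  · simp [hx l hl]
  · gcongr
    exacts [T.singularValues_nonneg _, T.singularValues_antitone hl]

theorem le_norm_map_of_inner_rightSingularBasis_eq_zero (T : E →ₗ[𝕜] F) (hn : finrank 𝕜 E = n)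
    {k : ℕ} {x : E} (hx : ∀ l : Fin n, k < (l : ℕ) → inner 𝕜 (rightSingularBasis T hn l) x = 0) :
    T.singularValues k * ‖x‖ ≤ ‖T x‖ := by
  refine le_of_sq_le_sq ?_ (norm_nonneg _)
  rw [mul_pow, norm_map_sq_eq_sum_rightSingularBasis T hn,
    ← (rightSingularBasis T hn).sum_sq_norm_inner_right x, Finset.mul_sum]
  refine Finset.sum_le_sum fun l _ => ?_
  rcases lt_or_ge k (l : ℕ) with hl | hl
  · simp [hx l hl]
  · gcongr
    exacts [T.singularValues_nonneg _, T.singularValues_antitone hl]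

-- The two directions of Courant–Fischer: the kernels of `f : E → 𝕜^k` stand for the subspaces of
-- codimension at most `k`.
theorem exists_forall_mem_ker_norm_map_le (T : E →ₗ[𝕜] F) (k : ℕ) :
    ∃ f : E →ₗ[𝕜] (Fin k → 𝕜), ∀ x ∈ f.ker, ‖T x‖ ≤ T.singularValues k * ‖x‖ := by
  let v := rightSingularBasis T rfl
  refine ⟨LinearMap.pi fun i => if h : (i : ℕ) < finrank 𝕜 E then innerₛₗ 𝕜 (v ⟨i, h⟩) else 0,
    fun x hx => norm_map_le_of_inner_rightSingularBasis_eq_zero T rfl fun l hl => ?_⟩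
  simpa [v] using congrFun hx ⟨l, hl⟩

theorem singularValues_le_of_forall_mem_ker (T : E →ₗ[𝕜] F) {k : ℕ} (f : E →ₗ[𝕜] (Fin k → 𝕜))
    {c : ℝ} (hc : 0 ≤ c) (hf : ∀ x ∈ f.ker, ‖T x‖ ≤ c * ‖x‖) : T.singularValues k ≤ c := by
  rcases le_or_gt (finrank 𝕜 E) k with hk | hk
  · rwa [T.singularValues_of_finrank_le hk]
  let v := rightSingularBasis T rfl
  let g : E →ₗ[𝕜] (Fin k → 𝕜) × (Finset.Ioi (⟨k, hk⟩ : Fin (finrank 𝕜 E)) → 𝕜) :=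
    f.prod (LinearMap.pi fun l => innerₛₗ 𝕜 (v l))
  have hker : g.ker ≠ ⊥ := LinearMap.ker_ne_bot_of_finrank_lt (by
    simp only [finrank_prod, finrank_fintype_fun_eq_card, Fintype.card_fin, Fintype.card_coe,
      Fin.card_Ioi]
    omega)
  obtain ⟨x, hx, hx0⟩ := Submodule.exists_mem_ne_zero_of_ne_bot hker
  obtain ⟨hxf, hxv⟩ := Prod.ext_iff.mp (LinearMap.mem_ker.mp hx)
  have hlow : T.singularValues k * ‖x‖ ≤ ‖T x‖ :=
    le_norm_map_of_inner_rightSingularBasis_eq_zero T rfl fun l hl =>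
      congrFun hxv ⟨l, Finset.mem_Ioi.mpr hl⟩
  exact le_of_mul_le_mul_right (hlow.trans (hf x hxf)) (norm_pos_iff.mpr hx0)

theorem singularValues_comp_le (A : F →ₗ[𝕜] G) (B : E →L[𝕜] F) (k : ℕ) :
    (A ∘ₗ B.toLinearMap).singularValues k ≤ A.singularValues k * ‖B‖ := by
  obtain ⟨f, hf⟩ := exists_forall_mem_ker_norm_map_le A k
  have hA := A.singularValues_nonneg k
  refine singularValues_le_of_forall_mem_ker _ (f ∘ₗ B.toLinearMap) (by positivity) fun x hx => ?_
  calc ‖A (B x)‖ ≤ A.singularValues k * ‖B x‖ := hf (B x) hx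
    _ ≤ A.singularValues k * (‖B‖ * ‖x‖) := by gcongr; exact B.le_opNorm x
    _ = A.singularValues k * ‖B‖ * ‖x‖ := (mul_assoc _ _ _).symm

theorem exists_orthonormalBasis_map_rightSingularBasis (T : E →ₗ[𝕜] F) (hE : finrank 𝕜 E = n)
    (hF : finrank 𝕜 F = n) :
    ∃ u : OrthonormalBasis (Fin n) 𝕜 F,
      ∀ l, T (rightSingularBasis T hE l) = (T.singularValues l : 𝕜) • u l := by
  let v := rightSingularBasis T hE
  let u : Fin n → F := fun l => (T.singularValues l : 𝕜)⁻¹ • T (v l)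
  have hu : Orthonormal 𝕜 (Set.domRestrict {l : Fin n | T.singularValues l ≠ 0} u) := by
    rw [orthonormal_iff_ite]
    rintro ⟨i, hi⟩ ⟨l, hl⟩
    have hi' : (T.singularValues i : 𝕜) ≠ 0 := RCLike.ofReal_ne_zero.mpr hi
    have hv := orthonormal_iff_ite.mp v.orthonormal i l
    simp only [Set.domRestrict_apply, u, inner_smul_left, inner_smul_right, v,
      inner_map_rightSingularBasis, map_inv₀, RCLike.conj_ofReal, Subtype.mk.injEq] at hv ⊢
    rw [hv]
    split_ifs with h
    · subst h
      field_simp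
    · simp
  obtain ⟨b, hb⟩ := hu.exists_orthonormalBasis_extension_of_card_eq (by simpa using hF)
  refine ⟨b, fun l => ?_⟩
  rcases eq_or_ne (T.singularValues l) 0 with hl | hl
  · have hself := inner_map_rightSingularBasis T hE l (v l)
    rw [hl, RCLike.ofReal_zero, zero_pow two_ne_zero, zero_mul, inner_self_eq_zero] at hself
    rw [hself, hl, RCLike.ofReal_zero, zero_smul]
  · rw [hb l hl, smul_inv_smul₀ (RCLike.ofReal_ne_zero.mpr hl)]

theorem exists_orthonormalBasis_norm_inner_map_le (T : E →ₗ[𝕜] F) (hE : finrank 𝕜 E = n)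
    (hF : finrank 𝕜 F = n) :
    ∃ u : OrthonormalBasis (Fin n) 𝕜 F,
      ∀ l x, ‖inner 𝕜 (u l) (T x)‖ ≤ T.singularValues l * ‖x‖ := by
  obtain ⟨u, hu⟩ := exists_orthonormalBasis_map_rightSingularBasis T hE hF
  refine ⟨u, fun l x => ?_⟩
  have hinner : inner 𝕜 (u l) (T x) =
      (T.singularValues l : 𝕜) * inner 𝕜 (rightSingularBasis T hE l) x := by
    nth_rewrite 1 [← (rightSingularBasis T hE).sum_repr' x]
    simp [inner_sum, inner_smul_right, hu, orthonormal_iff_ite.mp u.orthonormal, mul_comm]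
  rw [hinner, norm_mul, RCLike.norm_ofReal, abs_of_nonneg (T.singularValues_nonneg l)]
  gcongr
  · exact T.singularValues_nonneg l
  · simpa using norm_inner_le_norm (𝕜 := 𝕜) (rightSingularBasis T hE l) x

end SingularValues

section Boxes

variable {ι E : Type*} [Fintype ι] [NormedAddCommGroup E] [InnerProductSpace ℝ E]

/-- The closed rectangular box with centre `y`, axes along the orthonormal basis `u` and
half-side lengths `a`. -/
def orthoBox (u : OrthonormalBasis ι ℝ E) (y : E) (a : ι → ℝ) : Set E :=
  {x | ∀ l, |inner ℝ (u l) (x - y)| ≤ a l}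

theorem isClosed_orthoBox (u : OrthonormalBasis ι ℝ E) (y : E) (a : ι → ℝ) :
    IsClosed (orthoBox u y a) := by
  rw [orthoBox, Set.ofPred_forall]
  exact isClosed_iInter fun l => isClosed_le (by fun_prop) continuous_const

theorem volume_orthoBox [FiniteDimensional ℝ E] [MeasurableSpace E] [BorelSpace E]
    (u : OrthonormalBasis ι ℝ E) (y : E) (a : ι → ℝ) :
    volume (orthoBox u y a) = ∏ l, ENNReal.ofReal (2 * a l) := by
  have hcoord := (PiLp.volume_preserving_ofLp ι).comp u.measurePreserving_repr
  have hpreimage : orthoBox u y a = (WithLp.ofLp ∘ u.repr) ⁻¹'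
      Set.Icc (fun l => inner ℝ (u l) y - a l) (fun l => inner ℝ (u l) y + a l) := by
    ext x
    simp only [orthoBox, Set.mem_ofPred_eq, Set.mem_preimage, Set.mem_Icc, Pi.le_def,
      comp_apply, u.repr_apply_apply, inner_sub_right, abs_le, ← forall_and]
    refine forall_congr' fun l => ?_
    rw [neg_le_sub_iff_le_add, sub_le_iff_le_add, sub_le_iff_le_add, add_comm (a l)]
  rw [hpreimage, hcoord.measure_preimage measurableSet_Icc.nullMeasurableSet, Real.volume_Icc_pi]
  exact Finset.prod_congr rfl fun l _ => by ring_nf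

theorem mem_orthoBox_of_norm_sub_le {u : OrthonormalBasis ι ℝ E} {x x' y : E} {a : ι → ℝ} {d : ℝ}
    (hx' : x' ∈ orthoBox u y a) (hx : ‖x - x'‖ ≤ d) : x ∈ orthoBox u y fun l => a l + d := by
  intro l
  have hsplit : inner ℝ (u l) (x - y) = inner ℝ (u l) (x' - y) + inner ℝ (u l) (x - x') := by
    rw [← inner_add_right, add_comm, sub_add_sub_cancel]
  have hinner : |inner ℝ (u l) (x - x')| ≤ ‖x - x'‖ := by
    simpa using abs_real_inner_le_norm (u l) (x - x')
  rw [hsplit]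
  exact (abs_add_le _ _).trans (add_le_add (hx' l) (hinner.trans hx))

theorem mem_orthoBox_zero_of_norm_le (u : OrthonormalBasis ι ℝ E) {x : E} {R : ℝ}
    (hx : ‖x‖ ≤ R) : x ∈ orthoBox u 0 fun _ => R := fun l => by
  simpa using (abs_real_inner_le_norm (u l) x).trans (by simpa using hx)

theorem exists_image_closedBall_subset_orthoBox [FiniteDimensional ℝ E] {n : ℕ}
    (hn : finrank ℝ E = n) (T : E →ₗ[ℝ] E) :
    ∃ u : OrthonormalBasis (Fin n) ℝ E, ∀ (y : E) (R : ℝ),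
      (fun x => y + T x) '' Metric.closedBall 0 R ⊆
        orthoBox u y fun l => T.singularValues l * R := by
  obtain ⟨u, hu⟩ := exists_orthonormalBasis_norm_inner_map_le T hn hn
  refine ⟨u, fun y R => ?_⟩
  rintro _ ⟨x, hx, rfl⟩ l
  rw [mem_closedBall_zero_iff] at hx
  rw [add_sub_cancel_left, ← Real.norm_eq_abs]
  exact (hu l x).trans (mul_le_mul_of_nonneg_left hx (T.singularValues_nonneg l))

end Boxes

section MeshCubes

variable {N : ℕ} {r : ℝ}

theorem meshCube_eq_preimage (r : ℝ) (z : Fin N → ℤ) :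
    meshCube r z = WithLp.ofLp ⁻¹'
      Set.pi Set.univ fun l => Set.Ico ((z l : ℝ) * r) (((z l : ℝ) + 1) * r) := by
  ext x
  simp [meshCube]

theorem measurableSet_meshCube (r : ℝ) (z : Fin N → ℤ) : MeasurableSet (meshCube r z) := by
  rw [meshCube_eq_preimage]
  exact (PiLp.volume_preserving_ofLp (Fin N)).measurable
    (MeasurableSet.univ_pi fun _ => measurableSet_Ico)

theorem volume_meshCube (r : ℝ) (z : Fin N → ℤ) :
    volume (meshCube r z) = ENNReal.ofReal r ^ N := by
  have hside : ∀ l, ((z l : ℝ) + 1) * r - z l * r = r := fun l => by ring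
  rw [meshCube_eq_preimage, (PiLp.volume_preserving_ofLp (Fin N)).measure_preimage
    (MeasurableSet.univ_pi fun _ => measurableSet_Ico).nullMeasurableSet, Real.volume_pi_Ico]
  simp [hside]

theorem mem_meshCube_iff (hr : 0 < r) (z : Fin N → ℤ) (x : EuclideanSpace ℝ (Fin N)) :
    x ∈ meshCube r z ↔ z = fun l => ⌊x l / r⌋ := by
  rw [eq_comm, funext_iff]
  refine forall_congr' fun l => ?_
  rw [Int.floor_eq_iff, le_div_iff₀ hr, div_lt_iff₀ hr]

theorem pairwise_disjoint_meshCube (hr : 0 < r) :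
    Pairwise (Disjoint on meshCube (N := N) r) := fun z z' hz =>
  Set.disjoint_left.mpr fun x hx hx' =>
    hz (((mem_meshCube_iff hr z x).mp hx).trans ((mem_meshCube_iff hr z' x).mp hx').symm)

theorem measure_univ_eq_tsum_meshCube (hr : 0 < r) (τ : Measure (EuclideanSpace ℝ (Fin N))) :
    τ Set.univ = ∑' z, τ (meshCube r z) := by
  have hcover : ⋃ z, meshCube (N := N) r z = Set.univ :=
    Set.eq_univ_of_forall fun x => Set.mem_iUnion.mpr ⟨_, (mem_meshCube_iff hr _ x).mpr rfl⟩
  rw [← hcover, measure_iUnion (pairwise_disjoint_meshCube hr) (measurableSet_meshCube r)]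

theorem norm_sub_le_of_mem_meshCube (hr : 0 ≤ r) {z : Fin N → ℤ}
    {x y : EuclideanSpace ℝ (Fin N)} (hx : x ∈ meshCube r z) (hy : y ∈ meshCube r z) :
    ‖x - y‖ ≤ √N * r := by
  have hcoord : ∀ l, ‖(x - y) l‖ ≤ r := fun l => by
    rw [PiLp.sub_apply, Real.norm_eq_abs, abs_le]
    constructor <;> linarith [hx l, hy l]
  rw [EuclideanSpace.norm_eq, ← Real.sqrt_sq hr, ← Real.sqrt_mul (by positivity)]
  refine Real.sqrt_le_sqrt ?_
  calc ∑ l, ‖(x - y) l‖ ^ 2 ≤ ∑ _l : Fin N, r ^ 2 := by gcongr with l; exact hcoord l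
    _ = N * r ^ 2 := by simp

/-- A bound, by volume comparison, for the number of `r`-mesh cubes that meet a box in `ℝ^N` with
half-side lengths `a`. -/
noncomputable def boxCount (a : Fin N → ℝ) (r : ℝ) : ℝ :=
  ∏ l, 2 * (a l / r + √N)

theorem boxCount_nonneg (hr : 0 ≤ r) {a : Fin N → ℝ} (ha : ∀ l, 0 ≤ a l) : 0 ≤ boxCount a r :=
  Finset.prod_nonneg fun l _ => by
    have := ha l
    positivity

theorem boxCount_mul_pow (hr : r ≠ 0) (a : Fin N → ℝ) :
    boxCount a r * r ^ N = ∏ l, 2 * (a l + √N * r) := by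
  have hr' : r ^ N = ∏ _l : Fin N, r := by simp
  rw [boxCount, hr', ← Finset.prod_mul_distrib]
  exact Finset.prod_congr rfl fun l _ => by field_simp

theorem card_le_boxCount (hr : 0 < r) {u : OrthonormalBasis (Fin N) ℝ (EuclideanSpace ℝ (Fin N))}
    {y : EuclideanSpace ℝ (Fin N)} {a : Fin N → ℝ} (ha : ∀ l, 0 ≤ a l) {Z : Finset (Fin N → ℤ)}
    (hZ : ∀ z ∈ Z, (meshCube r z ∩ orthoBox u y a).Nonempty) : (Z.card : ℝ) ≤ boxCount a r := by
  have hsub : ⋃ z ∈ Z, meshCube r z ⊆ orthoBox u y fun l => a l + √N * r := by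
    refine Set.iUnion₂_subset fun z hz x hx => ?_
    obtain ⟨x', hx', hbox⟩ := hZ z hz
    exact mem_orthoBox_of_norm_sub_le hbox (norm_sub_le_of_mem_meshCube hr.le hx hx')
  have hside : ∀ l, 0 ≤ 2 * (a l + √N * r) := fun l => by
    have := ha l
    positivity
  have hvol : ENNReal.ofReal (Z.card * r ^ N) ≤ ENNReal.ofReal (boxCount a r * r ^ N) := by
    calc ENNReal.ofReal (Z.card * r ^ N) = ∑ z ∈ Z, volume (meshCube r z) := by
          simp only [volume_meshCube, Finset.sum_const, nsmul_eq_mul]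
          rw [ENNReal.ofReal_mul (by positivity), ENNReal.ofReal_natCast, ENNReal.ofReal_pow hr.le]
      _ = volume (⋃ z ∈ Z, meshCube r z) :=
          (measure_biUnion_finset (fun _ _ _ _ h => pairwise_disjoint_meshCube hr h)
            fun z _ => measurableSet_meshCube r z).symm
      _ ≤ volume (orthoBox u y fun l => a l + √N * r) := measure_mono hsub
      _ = ENNReal.ofReal (boxCount a r * r ^ N) := by
          rw [volume_orthoBox, boxCount_mul_pow hr.ne',
            ENNReal.ofReal_prod_of_nonneg fun l _ => hside l]
  rw [ENNReal.ofReal_le_ofReal_iff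
    (mul_nonneg (boxCount_nonneg hr.le ha) (pow_nonneg hr.le N))] at hvol
  exact le_of_mul_le_mul_right hvol (pow_pos hr N)

end MeshCubes

section MomentSums

variable {N : ℕ} {q r : ℝ}

theorem tsum_rpow_le_of_card_le {ι : Type*} (a : ι → ℝ≥0∞) (hq : 1 ≤ q) {K : ℝ}
    (hK : ∀ Z : Finset ι, (∀ z ∈ Z, a z ≠ 0) → (Z.card : ℝ) ≤ K) :
    (∑' z, a z) ^ q ≤ ENNReal.ofReal (K ^ (q - 1)) * ∑' z, a z ^ q := by
  classical
  have hq0 : 0 < q := by linarith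
  have hq1 : 0 ≤ q - 1 := by linarith
  have hK0 : 0 ≤ K := by simpa using hK ∅ (by simp)
  suffices hsum : ∑' z, a z ≤ (ENNReal.ofReal (K ^ (q - 1)) * ∑' z, a z ^ q) ^ q⁻¹ by
    rwa [ENNReal.le_rpow_inv_iff hq0] at hsum
  refine ENNReal.summable.tsum_le_of_sum_le fun Z => ?_
  rw [ENNReal.le_rpow_inv_iff hq0, ← Finset.sum_filter_ne_zero]
  refine (ENNReal.rpow_sum_le_const_mul_sum_rpow _ _ hq).trans ?_
  gcongr
  · rw [← ENNReal.ofReal_rpow_of_nonneg hK0 hq1, ← ENNReal.ofReal_natCast]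
    exact ENNReal.rpow_le_rpow (ENNReal.ofReal_le_ofReal (hK _ (by simp))) hq1
  · exact ENNReal.sum_le_tsum _

theorem tsum_rpow_le_rpow_tsum {ι : Type*} (a : ι → ℝ≥0∞) (hq : 1 ≤ q) :
    ∑' i, a i ^ q ≤ (∑' i, a i) ^ q := by
  have hsplit : ∀ x : ℝ≥0∞, x ^ q = x * x ^ (q - 1) := fun x => by
    nth_rewrite 2 [← ENNReal.rpow_one x]
    rw [← ENNReal.rpow_add_of_nonneg _ _ zero_le_one (by linarith), add_sub_cancel]
  rw [hsplit (∑' i, a i), ← ENNReal.tsum_mul_right]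
  refine ENNReal.tsum_le_tsum fun i => ?_
  rw [hsplit]
  exact mul_le_mul_right (ENNReal.rpow_le_rpow (ENNReal.le_tsum i) (by linarith)) _

theorem momentSum_mono (hq : 0 ≤ q) {τ τ' : Measure (EuclideanSpace ℝ (Fin N))} (h : τ ≤ τ') :
    momentSum τ q r ≤ momentSum τ' q r :=
  ENNReal.tsum_le_tsum fun _ => ENNReal.rpow_le_rpow (h _) hq

theorem tsum_momentSum_le_momentSum_sum {ι : Type*} (hq : 1 ≤ q)
    (τ : ι → Measure (EuclideanSpace ℝ (Fin N))) :
    ∑' i, momentSum (τ i) q r ≤ momentSum (Measure.sum τ) q r := by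
  unfold momentSum
  rw [ENNReal.tsum_comm]
  refine ENNReal.tsum_le_tsum fun z => (tsum_rpow_le_rpow_tsum _ hq).trans ?_
  exact ENNReal.rpow_le_rpow (Measure.le_sum_apply τ _) (by linarith)

theorem tsum_momentSum_map_restrict_le {X ι : Type*} [MeasurableSpace X] [Countable ι]
    (hq : 1 ≤ q) {f : X → EuclideanSpace ℝ (Fin N)} (hf : Measurable f) (μ : Measure X)
    {C : ι → Set X} (hC : ∀ i, MeasurableSet (C i)) (hdisj : Pairwise (Disjoint on C)) :
    ∑' i, momentSum ((μ.restrict (C i)).map f) q r ≤ momentSum (μ.map f) q r := by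
  refine (tsum_momentSum_le_momentSum_sum hq _).trans (momentSum_mono (by linarith) ?_)
  rw [← Measure.map_sum hf.aemeasurable, ← Measure.restrict_iUnion hdisj hC]
  exact Measure.map_mono Measure.restrict_le_self hf

theorem measure_univ_rpow_le_momentSum (hr : 0 < r) (hq : 1 ≤ q)
    {u : OrthonormalBasis (Fin N) ℝ (EuclideanSpace ℝ (Fin N))} {y : EuclideanSpace ℝ (Fin N)}
    {a : Fin N → ℝ} (ha : ∀ l, 0 ≤ a l) {τ : Measure (EuclideanSpace ℝ (Fin N))}
    (hτ : ∀ᵐ x ∂τ, x ∈ orthoBox u y a) :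
    τ Set.univ ^ q ≤ ENNReal.ofReal (boxCount a r ^ (q - 1)) * momentSum τ q r := by
  rw [measure_univ_eq_tsum_meshCube hr]
  refine tsum_rpow_le_of_card_le _ hq fun Z hZ =>
    card_le_boxCount (u := u) (y := y) hr ha fun z hz => ?_
  exact ((frequently_ae_mem_iff.mpr (hZ z hz)).and_eventually hτ).exists

theorem measure_rpow_le_momentSum_map_restrict {X : Type*} [MeasurableSpace X] (hr : 0 < r)
    (hq : 1 ≤ q) {f : X → EuclideanSpace ℝ (Fin N)} (hf : Measurable f) (μ : Measure X)
    {C : Set X} (hC : MeasurableSet C)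
    {u : OrthonormalBasis (Fin N) ℝ (EuclideanSpace ℝ (Fin N))} {y : EuclideanSpace ℝ (Fin N)}
    {a : Fin N → ℝ} (ha : ∀ l, 0 ≤ a l) (hfC : Set.MapsTo f C (orthoBox u y a)) :
    μ C ^ q ≤
      ENNReal.ofReal (boxCount a r ^ (q - 1)) * momentSum ((μ.restrict C).map f) q r := by
  have hτ : ∀ᵐ x ∂(μ.restrict C).map f, x ∈ orthoBox u y a :=
    (ae_map_iff hf.aemeasurable (isClosed_orthoBox u y a).measurableSet).mpr
      (ae_restrict_of_forall_mem hC hfC)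
  simpa [Measure.map_apply hf] using measure_univ_rpow_le_momentSum hr hq ha hτ

end MomentSums

section CodeSpace

variable {N m : ℕ}

theorem length_curtail (i : ℕ → Fin m) (k : ℕ) : (curtail i k).length = k :=
  List.length_ofFn

theorem curtail_add (i : ℕ → Fin m) (n k : ℕ) :
    curtail i (n + k) = curtail i n ++ curtail (fun l => i (n + l)) k := by
  simp [curtail, List.ofFn_add]

theorem curtail_succ (i : ℕ → Fin m) (k : ℕ) : curtail i (k + 1) = curtail i k ++ [i k] := by
  rw [curtail_add]
  simp [curtail]

theorem take_curtail (i : ℕ → Fin m) {n k : ℕ} (h : k ≤ n) :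
    (curtail i n).take k = curtail i k := by
  obtain ⟨d, rfl⟩ := Nat.exists_eq_add_of_le h
  rw [curtail_add, List.take_left' (length_curtail i k)]

theorem dropLast_curtail (i : ℕ → Fin m) (n : ℕ) :
    (curtail i n).dropLast = curtail i (n - 1) := by
  rw [List.dropLast_eq_take, length_curtail, take_curtail i (Nat.sub_le n 1)]

theorem continuous_curtail_comp {X : Type*} [TopologicalSpace X] (f : List (Fin m) → X) (k : ℕ) :
    Continuous fun i : ℕ → Fin m => f (curtail i k) :=
  (continuous_of_discreteTopology (f := fun v : Fin k → Fin m => f (List.ofFn v))).comp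
    (continuous_pi fun l => continuous_apply (l : ℕ))

theorem measurableSet_cylinder (w : List (Fin m)) : MeasurableSet (cylinder w) := by
  have hpreimage : cylinder w = (fun i => decide (curtail i w.length = w)) ⁻¹' {true} := by
    ext i
    simp [cylinder]
  rw [hpreimage]
  exact (continuous_curtail_comp (fun v => decide (v = w)) w.length).measurable
    (measurableSet_singleton true)

variable (T : Fin m → EuclideanSpace ℝ (Fin N) →L[ℝ] EuclideanSpace ℝ (Fin N))

theorem wordMap_cons (i : Fin m) (w : List (Fin m)) : wordMap T (i :: w) = T i * wordMap T w :=
  List.prod_cons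

theorem wordMap_append (v w : List (Fin m)) : wordMap T (v ++ w) = wordMap T v * wordMap T w := by
  simp [wordMap]

theorem wordMap_concat (w : List (Fin m)) (i : Fin m) :
    wordMap T (w ++ [i]) = wordMap T w * T i := by
  simp [wordMap]

theorem norm_wordMap_le {t : ℝ} (ht : ∀ i, ‖T i‖ ≤ t) (w : List (Fin m)) :
    ‖wordMap T w‖ ≤ t ^ w.length := by
  induction w with
  | nil => simpa [wordMap] using! ContinuousLinearMap.norm_id_le (𝕜 := ℝ)
  | cons i w ih =>
    have ht0 : 0 ≤ t := (norm_nonneg _).trans (ht i)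
    rw [wordMap_cons, List.length_cons, pow_succ']
    exact (norm_mul_le _ _).trans (mul_le_mul (ht i) ih (norm_nonneg _) ht0)

theorem injective_wordMap (hT : ∀ i, (T i).det ≠ 0) (w : List (Fin m)) :
    Injective (wordMap T w) := by
  induction w with
  | nil => exact injective_id
  | cons i w ih =>
    rw [wordMap_cons]
    exact ((T i).toContinuousLinearEquivOfDetNeZero (hT i)).injective.comp ih

theorem sv_nonneg (A : EuclideanSpace ℝ (Fin N) →L[ℝ] EuclideanSpace ℝ (Fin N)) (j : ℕ) :
    0 ≤ sv A j :=
  A.toLinearMap.singularValues_nonneg (j - 1)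

theorem sv_mul_le (A B : EuclideanSpace ℝ (Fin N) →L[ℝ] EuclideanSpace ℝ (Fin N)) (j : ℕ) :
    sv (A * B) j ≤ sv A j * ‖B‖ :=
  singularValues_comp_le A.toLinearMap B (j - 1)

theorem exists_mul_sv_le_sv_mul (hT : ∀ i, (T i).det ≠ 0) :
    ∃ c : ℝ, 0 < c ∧
      ∀ (A : EuclideanSpace ℝ (Fin N) →L[ℝ] EuclideanSpace ℝ (Fin N)) (i : Fin m) (j : ℕ),
        c * sv A j ≤ sv (A * T i) j := by
  let S : Fin m → EuclideanSpace ℝ (Fin N) →L[ℝ] EuclideanSpace ℝ (Fin N) := fun i =>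
    ((T i).toContinuousLinearEquivOfDetNeZero (hT i)).symm
  have hTS : ∀ i, T i * S i = 1 := fun i => by
    ext1 x
    exact ((T i).toContinuousLinearEquivOfDetNeZero (hT i)).apply_symm_apply x
  obtain ⟨M, hM⟩ := Finite.bddAbove_range fun i => ‖S i‖
  have hS : ∀ i, ‖S i‖ ≤ max 1 M := fun i => le_max_of_le_right (hM ⟨i, rfl⟩)
  have hpos : 0 < max 1 M := one_pos.trans_le (le_max_left _ _)
  refine ⟨(max 1 M)⁻¹, inv_pos.mpr hpos, fun A i j => ?_⟩
  rw [inv_mul_le_iff₀' hpos]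
  calc sv A j = sv (A * T i * S i) j := by rw [mul_assoc, hTS, mul_one]
    _ ≤ sv (A * T i) j * ‖S i‖ := sv_mul_le _ _ j
    _ ≤ sv (A * T i) j * max 1 M := mul_le_mul_of_nonneg_left (hS i) (sv_nonneg _ j)

theorem exists_mul_le_sv_of_mem_cutSet (hT : ∀ i, (T i).det ≠ 0) :
    ∃ c : ℝ, 0 < c ∧ ∀ {s r : ℝ} {w : List (Fin m)}, w ∈ cutSet T s r →
      c * r ≤ sv (wordMap T w) (svIndex N s) := by
  obtain ⟨c, hc, hcT⟩ := exists_mul_sv_le_sv_mul T hT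
  refine ⟨c, hc, fun {s r w} hw => ?_⟩
  rcases List.eq_nil_or_concat' w with rfl | ⟨v, i, rfl⟩
  · exact absurd (hw.2.trans_le hw.1) (lt_irrefl _)
  · have hv : r < sv (wordMap T v) (svIndex N s) := by simpa using hw.2
    rw [wordMap_concat]
    exact (mul_le_mul_of_nonneg_left hv.le hc.le).trans (hcT _ i _)

theorem antitone_sv_wordMap_curtail (hT : ∀ i, ‖T i‖ ≤ 1) (i : ℕ → Fin m) (j : ℕ) :
    Antitone fun n => sv (wordMap T (curtail i n)) j := by
  refine antitone_nat_of_succ_le fun n => ?_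
  rw [curtail_succ, wordMap_concat]
  exact (sv_mul_le _ _ j).trans (mul_le_of_le_one_right (sv_nonneg _ j) (hT (i n)))

theorem length_le_of_mem_cutSet (hT : ∀ i, ‖T i‖ ≤ 1) {s r : ℝ} {v w : List (Fin m)}
    (hv : v ∈ cutSet T s r) (hw : w ∈ cutSet T s r) {i : ℕ → Fin m} (hiv : i ∈ cylinder v)
    (hiw : i ∈ cylinder w) : w.length ≤ v.length := by
  have hiv' : curtail i v.length = v := hiv
  have hiw' : curtail i (w.length - 1) = w.dropLast := by rw [← dropLast_curtail, hiw]
  by_contra! hlt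
  have hanti := antitone_sv_wordMap_curtail T hT i (svIndex N s) (Nat.le_sub_one_of_lt hlt)
  simp only [hiv', hiw'] at hanti
  exact ((hv.1.trans_lt hw.2).trans_le hanti).false

theorem pairwise_disjoint_cylinder_cutSet (hT : ∀ i, ‖T i‖ ≤ 1) (s r : ℝ) :
    Pairwise (Disjoint on fun w : cutSet T s r => cylinder (w : List (Fin m))) := by
  rintro ⟨v, hv⟩ ⟨w, hw⟩ hvw
  refine Set.disjoint_left.mpr fun i hiv hiw => hvw (Subtype.ext ?_)
  have hlen : v.length = w.length :=
    (length_le_of_mem_cutSet T hT hw hv hiw hiv).antisymm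
      (length_le_of_mem_cutSet T hT hv hw hiv hiw)
  calc v = curtail i v.length := hiv.symm
    _ = curtail i w.length := by rw [hlen]
    _ = w := hiw

theorem exists_norm_le_lt_one (hT : ∀ i, ‖T i‖ < 1) : ∃ t : ℝ, 0 ≤ t ∧ t < 1 ∧ ∀ i, ‖T i‖ ≤ t := by
  have hle : ∀ᶠ t : ℝ in 𝓝[<] 1, ∀ i, ‖T i‖ ≤ t :=
    eventually_all.mpr fun i => mem_of_superset (Ioo_mem_nhdsLT (hT i)) fun _ ht => ht.1.le
  obtain ⟨t, ht, ht0, ht1⟩ := (hle.and (Ioo_mem_nhdsLT one_pos)).exists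
  exact ⟨t, ht0.le, ht1, ht⟩

theorem exists_summable_norm_wordMap_le (hT : ∀ i, ‖T i‖ < 1)
    {ω : List (Fin m) → EuclideanSpace ℝ (Fin N)} (hω : Bornology.IsBounded (Set.range ω)) :
    ∃ g : ℕ → ℝ, Summable g ∧ (∀ k, 0 ≤ g k) ∧ ∀ v w, ‖wordMap T v (ω w)‖ ≤ g v.length := by
  obtain ⟨t, ht0, ht1, ht⟩ := exists_norm_le_lt_one T hT
  obtain ⟨B, hB⟩ := hω.exists_norm_le
  have hB0 : 0 ≤ B := (norm_nonneg _).trans (hB _ ⟨[], rfl⟩)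
  refine ⟨fun k => t ^ k * B, (summable_geometric_of_lt_one ht0 ht1).mul_right B,
    fun k => by positivity, fun v w => ?_⟩
  exact ((wordMap T v).le_opNorm _).trans
    (mul_le_mul (norm_wordMap_le T ht v) (hB _ ⟨w, rfl⟩) (norm_nonneg _) (by positivity))

variable {T} {ω : List (Fin m) → EuclideanSpace ℝ (Fin N)} {g : ℕ → ℝ} (hg : Summable g)
  (hω : ∀ v w, ‖wordMap T v (ω w)‖ ≤ g v.length)
include hg hω

theorem summable_projection (i : ℕ → Fin m) :
    Summable fun k => wordMap T (curtail i k) (ω (curtail i (k + 1))) :=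
  .of_norm_bounded hg fun k => by simpa [length_curtail] using hω (curtail i k) _

theorem norm_projection_le (i : ℕ → Fin m) : ‖projection T ω i‖ ≤ ∑' k, g k :=
  tsum_of_norm_bounded hg.hasSum fun k => by simpa [length_curtail] using hω (curtail i k) _

theorem continuous_projection : Continuous (projection T ω) := by
  refine continuous_tsum (fun k => ?_) hg fun k i => by
    simpa [length_curtail] using hω (curtail i k) _
  simpa [take_curtail] using
    continuous_curtail_comp (fun v => wordMap T (v.take k) (ω v)) (k + 1)

theorem projection_eq_sum_add (i : ℕ → Fin m) (n : ℕ) :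
    projection T ω i = ∑ k ∈ Finset.range n, wordMap T (curtail i k) (ω (curtail i (k + 1))) +
      wordMap T (curtail i n)
        (projection T (fun v => ω (curtail i n ++ v)) fun l => i (n + l)) := by
  rw [projection, ← (summable_projection hg hω i).sum_add_tsum_nat_add n, projection,
    ContinuousLinearMap.map_tsum _ (summable_projection hg (fun v w => hω v _) _)]
  refine congrArg _ (tsum_congr fun k => ?_)
  rw [add_comm k n, add_assoc, curtail_add, curtail_add, wordMap_append]
  rfl

theorem exists_mapsTo_projection_cylinder (w : List (Fin m)) :
    ∃ y, Set.MapsTo (projection T ω) (cylinder w)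
      ((fun x => y + wordMap T w x) '' Metric.closedBall 0 (∑' k, g k)) := by
  refine ⟨∑ k ∈ Finset.range w.length, wordMap T (w.take k) (ω (w.take (k + 1))), fun i hi => ?_⟩
  have hw : curtail i w.length = w := hi
  refine ⟨projection T (fun v => ω (w ++ v)) fun l => i (w.length + l), ?_, ?_⟩
  · exact mem_closedBall_zero_iff.mpr (norm_projection_le hg (fun v _ => hω v _) _)
  · rw [projection_eq_sum_add hg hω i w.length, hw]
    refine congrArg (· + _) (Finset.sum_congr rfl fun k hk => ?_)
    have hk' : k < w.length := Finset.mem_range.mp hk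
    rw [← take_curtail i hk'.le, ← take_curtail i (Nat.succ_le_of_lt hk'), hw]

end CodeSpace

section CutSums

variable {N m : ℕ} {r s : ℝ}

theorem exists_svIndex_eq_add_one (hs : 0 < s) (hsN : s ≤ N) :
    ∃ p < N, svIndex N s = p + 1 ∧ s ≤ p + 1 := by
  obtain ⟨p, hp⟩ := Nat.exists_eq_add_one.mpr (Nat.ceil_pos.mpr hs)
  have hpN : p < N := by
    have := Nat.ceil_le.mpr hsN
    omega
  refine ⟨p, hpN, ?_, ?_⟩
  · rw [svIndex, hp]
    omega
  · exact (Nat.le_ceil s).trans_eq (by rw [hp, Nat.cast_add_one])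

theorem svFun_eq_of_svIndex_eq (A : EuclideanSpace ℝ (Fin N) →L[ℝ] EuclideanSpace ℝ (Fin N))
    {p : ℕ} (hsN : s ≤ N) (hp : svIndex N s = p + 1) :
    svFun A s = (∏ l ∈ Finset.range p, A.toLinearMap.singularValues l) *
      A.toLinearMap.singularValues p ^ (s - p) := by
  rw [svFun, if_pos hsN, hp, Finset.prod_Ico_eq_prod_range]
  simp [sv, sub_add]

theorem svFun_pos {A : EuclideanSpace ℝ (Fin N) →L[ℝ] EuclideanSpace ℝ (Fin N)}
    (hA : Injective A) (hs : 0 < s) (hsN : s ≤ N) : 0 < svFun A s := by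
  obtain ⟨p, hpN, hp, -⟩ := exists_svIndex_eq_add_one hs hsN
  have hσ : ∀ l < N, 0 < A.toLinearMap.singularValues l := by
    simpa using
      (LinearMap.injective_iff_forall_lt_finrank_singularValues_pos A.toLinearMap).mp hA
  rw [svFun_eq_of_svIndex_eq A hsN hp]
  exact mul_pos (Finset.prod_pos fun l hl => hσ l ((Finset.mem_range.mp hl).trans hpN))
    (Real.rpow_pos_of_pos (hσ p hpN) _)

theorem svFun_mul_rpow_neg (A : EuclideanSpace ℝ (Fin N) →L[ℝ] EuclideanSpace ℝ (Fin N))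
    {p : ℕ} (hsN : s ≤ N) (hp : svIndex N s = p + 1) (hr : 0 < r) :
    svFun A s * r ^ (-s) = (∏ l ∈ Finset.range p, A.toLinearMap.singularValues l / r) *
      (A.toLinearMap.singularValues p / r) ^ (s - p) := by
  have hsplit : r ^ (-s) = (r ^ p)⁻¹ * (r ^ (s - p))⁻¹ := by
    rw [← mul_inv, ← Real.rpow_natCast, ← Real.rpow_add hr, ← Real.rpow_neg hr.le,
      add_sub_cancel]
  rw [svFun_eq_of_svIndex_eq A hsN hp, hsplit, Finset.prod_div_distrib, Finset.prod_const,
    Finset.card_range, Real.div_rpow (A.toLinearMap.singularValues_nonneg p) hr.le]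
  ring

theorem prod_max_one_le {x : ℕ → ℝ} (hx : Antitone x) {c e : ℝ} {p n : ℕ} (hpn : p ≤ n)
    (hc : 0 < c) (hcx : c ≤ x p) (hx1 : x p ≤ 1) (he1 : e ≤ 1) :
    ∏ l ∈ Finset.range n, max 1 (x l) ≤
      c⁻¹ ^ (p + 1) * ((∏ l ∈ Finset.range p, x l) * x p ^ e) := by
  have hfirst : ∀ l ∈ Finset.range p, max 1 (x l) ≤ c⁻¹ * x l := fun l hl => by
    have hcl : c ≤ x l := hcx.trans (hx (Finset.mem_range.mp hl).le)
    rw [le_inv_mul_iff₀ hc]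
    exact (mul_max_of_nonneg _ _ hc.le).trans_le
      (max_le (by rwa [mul_one]) (mul_le_of_le_one_left (hc.le.trans hcl) (hcx.trans hx1)))
  have hlast : 1 ≤ c⁻¹ * x p ^ e := by
    rw [le_inv_mul_iff₀ hc, mul_one]
    exact hcx.trans (Real.self_le_rpow_of_le_one (hc.le.trans hcx) hx1 he1)
  calc ∏ l ∈ Finset.range n, max 1 (x l) = ∏ l ∈ Finset.range p, max 1 (x l) :=
        (Finset.prod_subset (Finset.range_subset_range.mpr hpn) fun l _ hl =>
          max_eq_left ((hx (by simpa using hl)).trans hx1)).symm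
    _ ≤ ∏ l ∈ Finset.range p, c⁻¹ * x l := Finset.prod_le_prod (fun l _ => by positivity) hfirst
    _ ≤ (∏ l ∈ Finset.range p, c⁻¹ * x l) * (c⁻¹ * x p ^ e) :=
        le_mul_of_one_le_right (Finset.prod_nonneg fun l hl =>
          (zero_le_one.trans (le_max_left _ _)).trans (hfirst l hl)) hlast
    _ = c⁻¹ ^ (p + 1) * ((∏ l ∈ Finset.range p, x l) * x p ^ e) := by
        rw [Finset.prod_mul_distrib, Finset.prod_const, Finset.card_range]
        ring

theorem boxCount_mul_const_le (hr : 0 ≤ r) {R : ℝ} (hR : 0 ≤ R) {a : Fin N → ℝ}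
    (ha : ∀ l, 0 ≤ a l) :
    boxCount (fun l => a l * R) r ≤ (2 * (R + √N)) ^ N * ∏ l, max 1 (a l / r) := by
  have hconst : (2 * (R + √N)) ^ N = ∏ _l : Fin N, 2 * (R + √N) := by simp
  rw [boxCount, hconst, ← Finset.prod_mul_distrib]
  refine Finset.prod_le_prod (fun l _ => ?_) fun l _ => ?_
  · have := ha l
    positivity
  · calc 2 * (a l * R / r + √N) = 2 * (R * (a l / r) + √N * 1) := by ring
      _ ≤ 2 * (R * max 1 (a l / r) + √N * max 1 (a l / r)) := by
        gcongr
        exacts [le_max_right _ _, le_max_left _ _]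
      _ = 2 * (R + √N) * max 1 (a l / r) := by ring

theorem boxCount_singularValues_le (hs : 0 < s) (hsN : s ≤ N) {c R : ℝ} (hc : 0 < c)
    (hR : 0 ≤ R) (hr : 0 < r) {A : EuclideanSpace ℝ (Fin N) →L[ℝ] EuclideanSpace ℝ (Fin N)}
    (hA : sv A (svIndex N s) ≤ r) (hA' : c * r ≤ sv A (svIndex N s)) :
    boxCount (fun l : Fin N => A.toLinearMap.singularValues l * R) r ≤
      (2 * (R + √N)) ^ N * c⁻¹ ^ svIndex N s * (svFun A s * r ^ (-s)) := by
  obtain ⟨p, hpN, hp, hsp⟩ := exists_svIndex_eq_add_one hs hsN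
  let x : ℕ → ℝ := fun l => A.toLinearMap.singularValues l / r
  have hx : Antitone x := fun l l' h =>
    div_le_div_of_nonneg_right (A.toLinearMap.singularValues_antitone h) hr.le
  have hsv : sv A (svIndex N s) = A.toLinearMap.singularValues p := by
    rw [hp, sv, Nat.add_sub_cancel]
  rw [hsv] at hA hA'
  rw [svFun_mul_rpow_neg A hsN hp hr, hp, mul_assoc]
  refine (boxCount_mul_const_le hr.le hR fun l => A.toLinearMap.singularValues_nonneg l).trans ?_
  gcongr
  rw [Fin.prod_univ_eq_prod_range (fun l => max 1 (x l))]
  exact prod_max_one_le hx hpN.le hc ((le_div_iff₀ hr).mpr hA') ((div_le_one hr).mpr hA)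
    (by linarith)

theorem rpow_one_sub_mul_rpow_le {F K b x q : ℝ} (hF : 0 < F) (hK : 0 ≤ K) (hx : 0 ≤ x)
    (hb : 0 ≤ b) (hbF : b ≤ K * (F * x)) (hq : 1 ≤ q) :
    F ^ (1 - q) * b ^ (q - 1) ≤ (K * x) ^ (q - 1) := by
  have hexp : (1 : ℝ) - q = -(q - 1) := by ring
  rw [hexp, Real.rpow_neg hF.le, inv_mul_le_iff₀ (Real.rpow_pos_of_pos hF _),
    ← Real.mul_rpow hF.le (by positivity)]
  exact Real.rpow_le_rpow hb (hbF.trans_eq (by ring)) (by linarith)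

variable {T : Fin m → EuclideanSpace ℝ (Fin N) →L[ℝ] EuclideanSpace ℝ (Fin N)}
  {ω : List (Fin m) → EuclideanSpace ℝ (Fin N)} {g : ℕ → ℝ} {q : ℝ}

theorem measure_cylinder_rpow_le (hg : Summable g)
    (hω : ∀ v w, ‖wordMap T v (ω w)‖ ≤ g v.length) (hR : 0 ≤ ∑' k, g k)
    (μ : Measure (ℕ → Fin m)) (hr : 0 < r) (hq : 1 ≤ q) (w : List (Fin m)) :
    μ (cylinder w) ^ q ≤
      ENNReal.ofReal (boxCount
        (fun l : Fin N => (wordMap T w).toLinearMap.singularValues l * ∑' k, g k) r ^ (q - 1)) *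
      momentSum ((μ.restrict (cylinder w)).map (projection T ω)) q r := by
  obtain ⟨y, hy⟩ := exists_mapsTo_projection_cylinder hg hω w
  obtain ⟨u, hu⟩ :=
    exists_image_closedBall_subset_orthoBox finrank_euclideanSpace_fin (wordMap T w).toLinearMap
  exact measure_rpow_le_momentSum_map_restrict hr hq (continuous_projection hg hω).measurable μ
    (measurableSet_cylinder w)
    (fun l => mul_nonneg ((wordMap T w).toLinearMap.singularValues_nonneg l) hR)
    fun i hi => hu y _ (hy hi)

theorem exists_cutSum_le (hTcontr : ∀ i, ‖T i‖ < 1) (hTnonsing : ∀ i, (T i).det ≠ 0)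
    (hω : Bornology.IsBounded (Set.range ω)) (μ : Measure (ℕ → Fin m)) (hq : 1 ≤ q)
    (hs : 0 < s) (hsN : s ≤ N) :
    ∃ K : ℝ, 0 ≤ K ∧ ∀ r > 0, cutSum T μ q s r ≤
      ENNReal.ofReal ((K * r ^ (-s)) ^ (q - 1)) * momentSum (projMeasure T ω μ) q r := by
  obtain ⟨g, hg, hg0, hgω⟩ := exists_summable_norm_wordMap_le T hTcontr hω
  obtain ⟨c, hc, hcut⟩ := exists_mul_le_sv_of_mem_cutSet T hTnonsing
  have hR : 0 ≤ ∑' k, g k := tsum_nonneg hg0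
  set R := ∑' k, g k
  refine ⟨(2 * (R + √N)) ^ N * c⁻¹ ^ svIndex N s, by positivity, fun r hr => ?_⟩
  have hterm : ∀ w : cutSet T s r,
      ENNReal.ofReal (svFun (wordMap T w) s ^ (1 - q)) * μ (cylinder w.1) ^ q ≤
        ENNReal.ofReal (((2 * (R + √N)) ^ N * c⁻¹ ^ svIndex N s * r ^ (-s)) ^ (q - 1)) *
          momentSum ((μ.restrict (cylinder w.1)).map (projection T ω)) q r := by
    rintro ⟨w, hw⟩
    have hpos : 0 < svFun (wordMap T w) s := svFun_pos (injective_wordMap T hTnonsing w) hs hsN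
    refine (mul_le_mul_right (measure_cylinder_rpow_le hg hgω hR μ hr hq w) _).trans ?_
    rw [← mul_assoc, ← ENNReal.ofReal_mul (by positivity)]
    gcongr
    exact rpow_one_sub_mul_rpow_le hpos (by positivity) (by positivity)
      (boxCount_nonneg hr.le fun l =>
        mul_nonneg ((wordMap T w).toLinearMap.singularValues_nonneg l) hR)
      (boxCount_singularValues_le hs hsN hc hR hr hw.1 (hcut hw)) hq
  calc cutSum T μ q s r ≤ _ := ENNReal.tsum_le_tsum hterm
    _ ≤ _ := by
      rw [ENNReal.tsum_mul_left]
      gcongr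
      exact tsum_momentSum_map_restrict_le hq (continuous_projection hg hgω).measurable μ
        (fun w => measurableSet_cylinder w.1)
        (pairwise_disjoint_cylinder_cutSet T (fun i => (hTcontr i).le) s r)

end CutSums

section Dimensions

variable {N m : ℕ} {q s : ℝ}

theorem ofReal_mul_rpow_neg_mul_le {K r t : ℝ} {M : ℝ≥0∞} (hK : 0 ≤ K) (hq : 1 < q)
    (hr : 0 < r) (hr1 : r < 1)
    (hs : (s : EReal) < ENNReal.log M / (((q - 1) * Real.log r : ℝ) : EReal)) :
    ENNReal.ofReal ((K * r ^ (-t)) ^ (q - 1)) * M ≤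
      ENNReal.ofReal ((K * r ^ (s - t)) ^ (q - 1)) := by
  have hlogr : (q - 1) * Real.log r < 0 :=
    mul_neg_of_pos_of_neg (by linarith) (Real.log_neg hr hr1)
  have hM : M ≤ ENNReal.ofReal (r ^ (s * (q - 1))) := by
    by_contra! hlt
    have hlog := ENNReal.log_le_log hlt.le
    rw [ENNReal.log_ofReal_of_pos (Real.rpow_pos_of_pos hr _), Real.log_rpow hr] at hlog
    refine hs.not_ge
      ((EReal.div_le_div_right_of_nonpos (by exact_mod_cast hlogr.le) hlog).trans_eq ?_)
    rw [← EReal.coe_div, mul_assoc, mul_div_cancel_right₀ _ hlogr.ne]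
  calc ENNReal.ofReal ((K * r ^ (-t)) ^ (q - 1)) * M
      ≤ ENNReal.ofReal ((K * r ^ (-t)) ^ (q - 1)) * ENNReal.ofReal (r ^ (s * (q - 1))) := by gcongr
    _ = ENNReal.ofReal ((K * r ^ (s - t)) ^ (q - 1)) := by
      rw [← ENNReal.ofReal_mul (by positivity), Real.rpow_mul hr.le,
        ← Real.mul_rpow (by positivity) (by positivity), mul_assoc, ← Real.rpow_add hr,
        neg_add_eq_sub]

theorem exists_measure_univ_rpow_le {τ : Measure (EuclideanSpace ℝ (Fin N))} {R : ℝ}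
    (hR : 0 ≤ R) (hτ : ∀ᵐ x ∂τ, ‖x‖ ≤ R) (hq : 1 ≤ q) :
    ∃ K : ℝ, 0 ≤ K ∧ ∀ r : ℝ, 0 < r → r < 1 →
      τ Set.univ ^ q ≤ ENNReal.ofReal ((K * r ^ (-(N : ℝ))) ^ (q - 1)) * momentSum τ q r := by
  refine ⟨(2 * (R + √N)) ^ N, by positivity, fun r hr hr1 => ?_⟩
  have hbox : ∀ᵐ x ∂τ, x ∈ orthoBox (EuclideanSpace.basisFun (Fin N) ℝ) 0 fun _ => 1 * R := by
    simp only [one_mul]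
    exact hτ.mono fun x hx => mem_orthoBox_zero_of_norm_le _ hx
  have hcount : boxCount (fun _ : Fin N => 1 * R) r ≤ (2 * (R + √N)) ^ N * r ^ (-(N : ℝ)) := by
    refine (boxCount_mul_const_le hr.le hR fun _ => zero_le_one).trans_eq ?_
    have hmax : max 1 r⁻¹ = r⁻¹ := max_eq_right ((one_le_inv₀ hr).mpr hr1.le)
    simp [hmax, Real.rpow_neg hr.le]
  refine (measure_univ_rpow_le_momentSum hr hq (fun _ => by positivity) hbox).trans ?_
  gcongr
  exact boxCount_nonneg hr.le fun _ => by positivity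

theorem upperDim_le_natCast {τ : Measure (EuclideanSpace ℝ (Fin N))} (hτ : τ ≠ 0) {R : ℝ}
    (hR : ∀ᵐ x ∂τ, ‖x‖ ≤ R) (hq : 1 < q) : upperDim q τ ≤ N := by
  have : (ae τ).NeBot := ae_neBot.mpr hτ
  obtain ⟨x, hx⟩ := hR.exists
  obtain ⟨K, hK0, hK⟩ := exists_measure_univ_rpow_le ((norm_nonneg x).trans hx) hR hq.le
  by_contra! hlt
  obtain ⟨s, hNs, hsdim⟩ := EReal.lt_iff_exists_real_btwn.mp hlt
  have hNs' : 0 < s - N := sub_pos.mpr (by exact_mod_cast hNs)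
  have hlim : Tendsto (fun r : ℝ => ENNReal.ofReal ((K * r ^ (s - N)) ^ (q - 1))) (𝓝[>] 0)
      (𝓝 0) := by
    have hpow : Tendsto (fun r : ℝ => K * r ^ (s - N)) (𝓝 0) (𝓝 0) := by
      simpa [hNs'.ne'] using
        ((Real.continuousAt_rpow_const 0 (s - N) (.inr hNs'.le)).tendsto.const_mul K)
    simpa [(sub_pos.mpr hq).ne'] using ENNReal.tendsto_ofReal
      ((hpow.mono_left nhdsWithin_le_nhds).rpow_const (.inr (sub_pos.mpr hq).le))
  have hfreq : ∃ᶠ r : ℝ in 𝓝[>] 0,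
      τ Set.univ ^ q ≤ ENNReal.ofReal ((K * r ^ (s - N)) ^ (q - 1)) :=
    ((frequently_lt_of_lt_limsup (by isBoundedDefault) hsdim).and_eventually
      (Ioo_mem_nhdsGT one_pos)).mono fun r ⟨hr, hr0, hr1⟩ =>
        (hK r hr0 hr1).trans (ofReal_mul_rpow_neg_mul_le hK0 hq hr0 hr1 hr)
  have hzero : τ Set.univ ^ q ≤ 0 := ge_of_tendsto_of_frequently hlim hfreq
  rw [nonpos_iff_eq_zero, ENNReal.rpow_eq_zero_iff_of_pos (by linarith),
    Measure.measure_univ_eq_zero] at hzero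
  exact hτ hzero

theorem le_coe_min_of_forall_between {L : EReal} {d : ℝ≥0∞} (hLN : L ≤ N)
    (h : ∀ s : ℝ, 0 < s → s ≤ N → (s : EReal) < L → ENNReal.ofReal s ≤ d) :
    L ≤ ((min d N : ℝ≥0∞) : EReal) := by
  have hN : ((N : ℝ≥0∞) : EReal) = N := by norm_cast
  rw [EReal.coe_ennreal_strictMono.monotone.map_min, hN]
  refine le_min ?_ hLN
  by_contra! hlt
  obtain ⟨s, hds, hsL⟩ := EReal.lt_iff_exists_real_btwn.mp hlt
  have hs : 0 < s := by exact_mod_cast (EReal.coe_ennreal_nonneg d).trans_lt hds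
  have hsN : s ≤ N := by exact_mod_cast (hsL.trans_le hLN).le
  have hle := EReal.coe_ennreal_le_coe_ennreal_iff.mpr (h s hs hsN hsL)
  rw [EReal.coe_ennreal_ofReal, max_eq_left hs.le] at hle
  exact hds.not_ge hle

variable {T : Fin m → EuclideanSpace ℝ (Fin N) →L[ℝ] EuclideanSpace ℝ (Fin N)}
  {ω : List (Fin m) → EuclideanSpace ℝ (Fin N)}

theorem upperDim_projMeasure_le_natCast (hTcontr : ∀ i, ‖T i‖ < 1)
    (hω : Bornology.IsBounded (Set.range ω)) {μ : Measure (ℕ → Fin m)} (hμ : μ ≠ 0)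
    (hq : 1 < q) : upperDim q (projMeasure T ω μ) ≤ N := by
  obtain ⟨g, hg, -, hgω⟩ := exists_summable_norm_wordMap_le T hTcontr hω
  have hmeas := (continuous_projection hg hgω).measurable.aemeasurable (μ := μ)
  refine upperDim_le_natCast ((Measure.map_eq_zero_iff hmeas).not.mpr hμ) (R := ∑' k, g k) ?_ hq
  exact (ae_map_iff hmeas (measurableSet_le (by fun_prop) measurable_const)).mpr
    (ae_of_all _ (norm_projection_le hg hgω))

theorem exists_cutSum_le_of_lt_log_div (hTcontr : ∀ i, ‖T i‖ < 1)
    (hTnonsing : ∀ i, (T i).det ≠ 0) (hω : Bornology.IsBounded (Set.range ω))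
    (μ : Measure (ℕ → Fin m)) (hq : 1 < q) (hs : 0 < s) (hsN : s ≤ N) :
    ∃ C < ∞, ∀ r : ℝ, 0 < r → r < 1 →
      (s : EReal) < ENNReal.log (momentSum (projMeasure T ω μ) q r) /
        (((q - 1) * Real.log r : ℝ) : EReal) →
      cutSum T μ q s r ≤ C := by
  obtain ⟨K, hK0, hK⟩ := exists_cutSum_le hTcontr hTnonsing hω μ hq.le hs hsN
  refine ⟨ENNReal.ofReal ((K * 1) ^ (q - 1)), ENNReal.ofReal_lt_top, fun r hr hr1 hlt => ?_⟩
  simpa using (hK r hr).trans (ofReal_mul_rpow_neg_mul_le hK0 hq hr hr1 hlt)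

theorem lowerDim_projMeasure_le_min (hTcontr : ∀ i, ‖T i‖ < 1)
    (hTnonsing : ∀ i, (T i).det ≠ 0) (hω : Bornology.IsBounded (Set.range ω))
    {μ : Measure (ℕ → Fin m)} (hμ : μ ≠ 0) (hq : 1 < q) :
    lowerDim q (projMeasure T ω μ) ≤ ((min (dMinus T μ q) N : ℝ≥0∞) : EReal) := by
  have hN : lowerDim q (projMeasure T ω μ) ≤ N :=
    le_trans liminf_le_limsup (upperDim_projMeasure_le_natCast hTcontr hω hμ hq)
  refine le_coe_min_of_forall_between hN fun s hs hsN hsL => ?_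
  obtain ⟨C, hC, hcut⟩ := exists_cutSum_le_of_lt_log_div hTcontr hTnonsing hω μ hq hs hsN
  refine le_iSup₂_of_le s ⟨hs, (limsup_le_of_le (by isBoundedDefault) ?_).trans_lt hC⟩ le_rfl
  filter_upwards [eventually_lt_of_lt_liminf hsL, Ioo_mem_nhdsGT one_pos] with r hr hr01
  exact hcut r hr01.1 hr01.2 hr

theorem upperDim_projMeasure_le_min (hTcontr : ∀ i, ‖T i‖ < 1)
    (hTnonsing : ∀ i, (T i).det ≠ 0) (hω : Bornology.IsBounded (Set.range ω))
    {μ : Measure (ℕ → Fin m)} (hμ : μ ≠ 0) (hq : 1 < q) :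
    upperDim q (projMeasure T ω μ) ≤ ((min (dPlus T μ q) N : ℝ≥0∞) : EReal) := by
  refine le_coe_min_of_forall_between (upperDim_projMeasure_le_natCast hTcontr hω hμ hq)
    fun s hs hsN hsL => ?_
  obtain ⟨C, hC, hcut⟩ := exists_cutSum_le_of_lt_log_div hTcontr hTnonsing hω μ hq hs hsN
  have hfreq : ∃ᶠ r in 𝓝[>] 0, cutSum T μ q s r ≤ C :=
    ((frequently_lt_of_lt_limsup (by isBoundedDefault) hsL).and_eventually
      (Ioo_mem_nhdsGT one_pos)).mono fun r ⟨hr, hr0, hr1⟩ => hcut r hr0 hr1 hr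
  exact le_iSup₂_of_le s
    ⟨hs, (liminf_le_of_frequently_le hfreq (by isBoundedDefault)).trans_lt hC⟩ le_rfl

end Dimensions

end AlmostSelfAffine

theorem corollary4p3_general {N m : ℕ}
    (T : Fin m → EuclideanSpace ℝ (Fin N) →L[ℝ] EuclideanSpace ℝ (Fin N))
    (hTcontr : ∀ i, ‖T i‖ < 1) (hTnonsing : ∀ i, (T i).det ≠ 0)
    (μ : Measure (ℕ → Fin m)) (hμ : μ ≠ 0) (q : ℝ) (hq : 1 < q)
    (ω : List (Fin m) → EuclideanSpace ℝ (Fin N)) (hω : Bornology.IsBounded (Set.range ω)) :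
    AlmostSelfAffine.lowerDim q (AlmostSelfAffine.projMeasure T ω μ) ≤
        ((min (AlmostSelfAffine.dMinus T μ q) (N : ℝ≥0∞) : ℝ≥0∞) : EReal) ∧
      AlmostSelfAffine.upperDim q (AlmostSelfAffine.projMeasure T ω μ) ≤
        ((min (AlmostSelfAffine.dPlus T μ q) (N : ℝ≥0∞) : ℝ≥0∞) : EReal) :=
  ⟨AlmostSelfAffine.lowerDim_projMeasure_le_min hTcontr hTnonsing hω hμ hq,
    AlmostSelfAffine.upperDim_projMeasure_le_min hTcontr hTnonsing hω hμ hq⟩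

theorem corollary4p3 {N m : ℕ}
    (T : Fin m → EuclideanSpace ℝ (Fin N) →L[ℝ] EuclideanSpace ℝ (Fin N))
    (hTcontr : ∀ i, ‖T i‖ < 1) (hTnonsing : ∀ i, (T i).det ≠ 0)
    (μ : Measure (ℕ → Fin m)) [IsFiniteMeasure μ] (hμ : μ ≠ 0)
    (q : ℝ) (hq : 1 < q)
    (D : Set (EuclideanSpace ℝ (Fin N))) (hD : Bornology.IsBounded D)
    (ω : List (Fin m) → EuclideanSpace ℝ (Fin N)) (hω : ∀ w, ω w ∈ D) :
    AlmostSelfAffine.lowerDim q (AlmostSelfAffine.projMeasure T ω μ) ≤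
        ((min (AlmostSelfAffine.dMinus T μ q) (N : ℝ≥0∞) : ℝ≥0∞) : EReal) ∧
      AlmostSelfAffine.upperDim q (AlmostSelfAffine.projMeasure T ω μ) ≤
        ((min (AlmostSelfAffine.dPlus T μ q) (N : ℝ≥0∞) : ℝ≥0∞) : EReal) := by
  exact corollary4p3_general T hTcontr hTnonsing μ hμ q hq ω
    (hD.subset (Set.range_subset_iff.mpr hω))
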